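/- **Model.** For $k\in\{1,2\}$ let $\mathcal E^{(k)},\mathcal S^{(k)}$ be disjoint finite sets with intensity matrices $A^{(k)}_{\mathcal E\mathcal E}$, $A^{(k)}_{\mathcal S\mathcal S}$ (nonnegative off-diagonal entries, zero row sums), reward rates $r^{(k)}:\mathcal E^{(k)}\to\mathbb R\setminus\{0\}$, $\rho^{(k)}:\mathcal S^{(k)}\to\mathbb R\setminus\{0\}$, a transition matrix $P^{(k)}$ from $\mathcal E^{(k)}$ to $\mathcal S^{(k)}$ and an initial state $i^{(k)}\in\mathcal E^{(k)}$ with $r^{(k)}(i^{(k)})>0$; let $\gamma_0>0$ dominate the absolute values of all diagonal entries of the intensity matrices. The ruin-dependent bivariate stochastic fluid process $((F^{(1)},J^{(1)}),(F^{(2)},J^{(2)}))$ is built by uniformization on two independent Poisson processes $\Theta^{(1)},\Theta^{(2)}$ of intensity $\gamma_0$. Here $J^{(k)}$ starts in $i^{(k)}$, and at each arrival of $\Theta^{(k)}$ it moves from $i$ to $j$ with probability $(I+A^{(k)}_{\mathcal E\mathcal E}/\gamma_0)_{ij}$ before the first ruin time $$\tau^{[1]}=\inf\{s>0:F^{(1)}(s)=0\text{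 or }F^{(2)}(s)=0\},$$ and with probability $(I+A^{(k)}_{\mathcal S\mathcal S}/\gamma_0)_{ij}$ after it. At $\tau^{[1]}$ both $J^{(1)}$ and $J^{(2)}$ switch, $J^{(k)}$ moving from $i\in\mathcal E^{(k)}$ to $j\in\mathcal S^{(k)}$ with probability $P^{(k)}_{ij}$. All these transitions are drawn independently. The level is $F^{(k)}(t)=\int_0^{t}\big(r^{(k)}(J^{(k)}(s))\mathbf 1_{s<\tau^{[1]}}+\rho^{(k)}(J^{(k)}(s))\mathbf 1_{s\ge\tau^{[1]}}\big)\,ds$. **Observation.** For every integer $\gamma>\gamma_0$ let $\widehat\Theta^{(1)}_\gamma,\widehat\Theta^{(2)}_\gamma$ be Poisson processes of intensity $\gamma-\gamma_0$, independent of each other and of the process above (with arbitrary dependence between different values of $\gamma$), and let $\widetilde\Theta^{(k)}_\gamma$, with arrivals $\widetilde\theta^{(k)}_1\le\widetilde\theta^{(k)}_2\le\cdots$, be the superposition of $\Theta^{(k)}$ and $\widehat\Theta^{(k)}_\gamma$. On $\{\tau^{[1]}<\infty\}$ the superscript $[1]$ stands for the coordinate $k$ with $F^{(k)}(\tau^{[1]})=0$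 (in case of a tie, $k=1$), and $[2]$ for the other one. Put $$\ell_*=\inf\{\ell\ge1:\tau^{[1]}<\widetilde\theta^{[1]}_\ell\},\qquad \sigma^{[1]}_*=\widetilde\theta^{[1]}_{\ell_*},\qquad \sigma^{[2]}_*=\widetilde\theta^{[2]}_{\ell_*}.$$ **Statement.** Almost surely on $\{\tau^{[1]}<\infty\}$, $\sigma^{[k]}_*\to\tau^{[1]}$ for $k=1,2$ as $\gamma\to\infty$ along the integers. Moreover, almost surely on $\{\tau^{[1]}<\infty,\ \rho^{[1]}(J^{[1]}(\tau^{[1]}))<0\}$, the same holds when $\ell_*$ is replaced by $\inf\{\ell\ge1:F^{[1]}(\widetilde\theta^{[1]}_\ell)<0\}$, with $\widetilde\theta^{[k]}_\infty=\infty$. -/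

import Mathlib

open MeasureTheory ProbabilityTheory Filter Topology

namespace RuinFluid

noncomputable section

/-- Intensity matrix of a (conservative) Markov jump process on a finite set. -/
def IsIntensityMatrix {ι : Type*} [Fintype ι] (A : Matrix ι ι ℝ) : Prop :=
  (∀ i j, i ≠ j → 0 ≤ A i j) ∧ ∀ i, ∑ j, A i j = 0

/-- (Possibly rectangular) transition matrix. -/
def IsTransitionMatrix {ι κ : Type*} [Fintype κ] (P : Matrix ι κ ℝ) : Prop :=
  (∀ i j, 0 ≤ P i j) ∧ ∀ i, ∑ j, P i j = 1

/-- Parameters of a ruin-dependent bivariate stochastic fluid process. The two coordinates are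
indexed by `Fin 2`; `E k` and `S k` are the environmental states of coordinate `k` before and
after the behavioral switch. -/
structure Params (E S : Fin 2 → Type*) [∀ k, Fintype (E k)] [∀ k, Fintype (S k)] where
  /-- intensity matrix before the switch -/
  AE : ∀ k, Matrix (E k) (E k) ℝ
  /-- intensity matrix after the switch -/
  AS : ∀ k, Matrix (S k) (S k) ℝ
  /-- transition matrix used at the switch -/
  P : ∀ k, Matrix (E k) (S k) ℝ
  /-- reward rates before the switch -/
  r : ∀ k, E k → ℝ
  /-- reward rates after the switch -/
  ρ : ∀ k, S k → ℝ
  /-- initial states -/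
  init : ∀ k, E k
  /-- uniformization rate -/
  γ₀ : ℝ
  intensityE : ∀ k, IsIntensityMatrix (AE k)
  intensityS : ∀ k, IsIntensityMatrix (AS k)
  transitionP : ∀ k, IsTransitionMatrix (P k)
  r_ne : ∀ k i, r k i ≠ 0
  ρ_ne : ∀ k i, ρ k i ≠ 0
  init_pos : ∀ k, 0 < r k (init k)
  γ₀_pos : 0 < γ₀
  boundE : ∀ k i, |AE k i i| ≤ γ₀
  boundS : ∀ k i, |AS k i i| ≤ γ₀

/-- `ℓ`-th epoch of the point process with inter-arrival times `x 0, x 1, …`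
(epoch `0` is time `0`). -/
def epoch (x : ℕ → ℝ) (ℓ : ℕ) : ℝ := ∑ i ∈ Finset.range ℓ, x i

/-- Number of arrivals (epochs with index at least `1`) in `[0, t]`. -/
def count (x : ℕ → ℝ) (t : ℝ) : ℕ := {ℓ : ℕ | 1 ≤ ℓ ∧ epoch x ℓ ≤ t}.ncard

/-- Number of arrivals (epochs with index at least `1`) in `[0, t)`. -/
def countLT (x : ℕ → ℝ) (t : ℝ) : ℕ := {ℓ : ℕ | 1 ≤ ℓ ∧ epoch x ℓ < t}.ncard

/-- `ℓ`-th epoch of the superposition of two point processes, given by their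
inter-arrival times (epoch `0` is time `0`). -/
def superEpoch (x y : ℕ → ℝ) (ℓ : ℕ) : ℝ := sInf {t : ℝ | 0 ≤ t ∧ ℓ ≤ count x t + count y t}

/-- One realization of the randomness that drives the uniformization construction: for each
coordinate, the inter-arrival times of the Poisson grid of intensity `γ₀`, the transition maps
applied at the arrivals of that grid (before and after the switch), and the map that is applied
at the switch. -/
structure Drive (E S : Fin 2 → Type*) where
  gap : Fin 2 → ℕ → ℝ
  stepE : ∀ k, ℕ → E k → E k
  stepS : ∀ k, ℕ → S k → S k
  switch : ∀ k, E k → S k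

section Path

variable {E S : Fin 2 → Type*} [∀ k, Fintype (E k)] [∀ k, Fintype (S k)]
  (p : Params E S) (d : Drive E S)

/-- The chain of environmental states before the switch: the `ℓ`-th arrival (`ℓ ≥ 1`) applies the
map `stepE k (ℓ - 1)`. -/
def preChain (k : Fin 2) : ℕ → E k
  | 0 => p.init k
  | ℓ + 1 => d.stepE k ℓ (preChain k ℓ)

/-- Level process of coordinate `k` with the behavioral switch ignored. -/
def preLevel (k : Fin 2) (t : ℝ) : ℝ :=
  ∫ s in (0 : ℝ)..t, p.r k (preChain p d k (count (d.gap k) s))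

/-- The time of the behavioral switch: the first time at which a level process that has not
switched yet hits `0` (`⊤` if this never happens). -/
def switchTime : EReal :=
  sInf ((fun s : ℝ => (s : EReal)) '' {s : ℝ | 0 < s ∧ ∃ k, preLevel p d k s = 0})

/-- The chain of environmental states after the switch. The start is drawn from the state just
before the switch; arrivals after the switch continue with the maps that follow those of
the arrivals up to the switch. -/
def postChain (k : Fin 2) : ℕ → S k
  | 0 => d.switch k (preChain p d k (countLT (d.gap k) (switchTime p d).toReal))
  | n + 1 => d.stepS k (count (d.gap k) (switchTime p d).toReal + n) (postChain k n)

open Classical in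
/-- The environmental process `J^{(k)}`, with values in `E k` before the switch and in `S k`
from the switch on. -/
def env (k : Fin 2) (t : ℝ) : E k ⊕ S k :=
  if (t : EReal) < switchTime p d then Sum.inl (preChain p d k (count (d.gap k) t))
  else Sum.inr (postChain p d k
    (count (d.gap k) t - count (d.gap k) (switchTime p d).toReal))

/-- The current reward rate of coordinate `k`. -/
def rate (k : Fin 2) (t : ℝ) : ℝ := Sum.elim (p.r k) (p.ρ k) (env p d k t)

/-- The level process `F^{(k)}`. -/
def level (k : Fin 2) (t : ℝ) : ℝ := ∫ s in (0 : ℝ)..t, rate p d k s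

/-- The first ruin time `τ^{[1]} = inf {s > 0 : F^{(1)}(s) = 0 or F^{(2)}(s) = 0}`, with
value `⊤` if there is no ruin. -/
def ruinTime : EReal :=
  sInf ((fun s : ℝ => (s : EReal)) '' {s : ℝ | 0 < s ∧ ∃ k, level p d k s = 0})

open Classical in
/-- `order 0` is the coordinate `[1]`, which is ruined first, and `order 1` is the other
coordinate `[2]`. -/
def order (j : Fin 2) : Fin 2 :=
  if level p d 0 (ruinTime p d).toReal = 0 then j else j.rev

/-- The grid `Θ̃^{(k)}`: superposition of the grid of `d` with a second one, given by the
inter-arrival times `hat k`. -/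
def grid (hat : Fin 2 → ℕ → ℝ) (k : Fin 2) (ℓ : ℕ) : ℝ := superEpoch (d.gap k) (hat k) ℓ

/-- `ℓ_*`: index of the first arrival of `Θ̃^{[1]}` after the first ruin time. -/
def ellStar (hat : Fin 2 → ℕ → ℝ) : ℕ∞ :=
  sInf ((fun ℓ : ℕ => (ℓ : ℕ∞)) ''
    {ℓ : ℕ | 1 ≤ ℓ ∧ ruinTime p d < (grid d hat (order p d 0) ℓ : EReal)})

/-- The index of the first arrival of `Θ̃^{[1]}` at which `F^{[1]}` is observed below `0`. -/
def ellNeg (hat : Fin 2 → ℕ → ℝ) : ℕ∞ :=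
  sInf ((fun ℓ : ℕ => (ℓ : ℕ∞)) ''
    {ℓ : ℕ | 1 ≤ ℓ ∧ level p d (order p d 0) (grid d hat (order p d 0) ℓ) < 0})

/-- The epoch with (possibly infinite) index `ℓ` of `Θ̃^{[1]}` (`j = 0`), `Θ̃^{[2]}` (`j = 1`). -/
def gridAt (hat : Fin 2 → ℕ → ℝ) (j : Fin 2) : ℕ∞ → EReal
  | ⊤ => ⊤
  | (ℓ : ℕ) => (grid d hat (order p d j) ℓ : EReal)

/-- The Poisson-observed switching times `σ_*^{[1]}` (`j = 0`) and `σ_*^{[2]}` (`j = 1`). -/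
def sigmaStar (hat : Fin 2 → ℕ → ℝ) (j : Fin 2) : EReal := gridAt p d hat j (ellStar p d hat)

/-- The analogue of `sigmaStar` where ruin is detected by observing `F^{[1]}` below `0`. -/
def sigmaNeg (hat : Fin 2 → ℕ → ℝ) (j : Fin 2) : EReal := gridAt p d hat j (ellNeg p d hat)

end Path

section Sanity
variable {E S : Fin 2 → Type*} [∀ k, Fintype (E k)] [∀ k, Fintype (S k)]
  (p : Params E S) (d : Drive E S)

theorem finite_count {x : ℕ → ℝ} (hx : Tendsto (epoch x) atTop atTop) (t : ℝ) :
    {ℓ : ℕ | 1 ≤ ℓ ∧ epoch x ℓ ≤ t}.Finite := by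
  obtain ⟨N, hN⟩ := (hx.eventually_gt_atTop t).exists_forall_of_atTop
  refine (Set.finite_lt_nat N).subset fun ℓ hℓ => ?_
  by_contra h
  exact absurd hℓ.2 (not_le.2 (hN ℓ (not_lt.1 h)))

theorem count_mono {x : ℕ → ℝ} (hx : Tendsto (epoch x) atTop atTop) : Monotone (count x) := by
  intro s t hst
  exact Set.ncard_le_ncard (fun ℓ h => ⟨h.1, h.2.trans hst⟩) (finite_count hx t)

theorem measurable_pre {d : Drive E S} (k : Fin 2) (hx : Tendsto (epoch (d.gap k)) atTop atTop) :
    Measurable fun s => p.r k (preChain p d k (count (d.gap k) s)) :=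
  (measurable_from_top (f := fun n : ℕ => p.r k (preChain p d k n))).comp
    (count_mono hx).measurable

theorem intble_pre {d : Drive E S} (k : Fin 2) (hx : Tendsto (epoch (d.gap k)) atTop atTop)
    (a b : ℝ) : IntervalIntegrable (fun s => p.r k (preChain p d k (count (d.gap k) s)))
      volume a b := by
  have : IntervalIntegrable (fun _ : ℝ => ∑ i, |p.r k i|) volume a b :=
    intervalIntegrable_const
  refine this.mono_fun (measurable_pre p k hx).aestronglyMeasurable (Eventually.of_forall ?_)
  intro s
  simp only [Real.norm_eq_abs]
  refine le_trans ?_ (le_abs_self _)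
  exact Finset.single_le_sum (f := fun i => |p.r k i|) (fun i _ => abs_nonneg _)
    (Finset.mem_univ _)

theorem continuous_pre {d : Drive E S} (k : Fin 2) (hx : Tendsto (epoch (d.gap k)) atTop atTop) :
    Continuous (preLevel p d k) :=
  intervalIntegral.continuous_primitive (fun a b => intble_pre p k hx a b) 0

theorem level_eq_pre (k : Fin 2) {t : ℝ} (h0 : 0 ≤ t) (ht : (t : EReal) ≤ switchTime p d) :
    level p d k t = preLevel p d k t := by
  refine intervalIntegral.integral_congr_ae ?_
  have : ∀ᵐ s : ℝ ∂volume, s ≠ t := by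
    simp [ae_iff]
  filter_upwards [this] with s hs hst
  rw [Set.uIoc_of_le h0] at hst
  have h1 : (s : EReal) < switchTime p d :=
    lt_of_lt_of_le (EReal.coe_lt_coe_iff.2 (lt_of_le_of_ne hst.2 hs)) ht
  simp [rate, env, h1]

theorem pre_small {d : Drive E S} (k : Fin 2) (hpos : ∀ ℓ, 0 < d.gap k ℓ) {t : ℝ}
    (h0 : 0 ≤ t) (ht : t < d.gap k 0) : preLevel p d k t = t * p.r k (p.init k) := by
  have : ∀ s ∈ Set.uIcc 0 t, p.r k (preChain p d k (count (d.gap k) s)) = p.r k (p.init k) := by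
    intro s hs
    rw [Set.uIcc_of_le h0] at hs
    have hc : count (d.gap k) s = 0 := by
      have : {ℓ : ℕ | 1 ≤ ℓ ∧ epoch (d.gap k) ℓ ≤ s} = ∅ := by
        ext ℓ
        simp only [Set.mem_ofPred_eq, Set.mem_empty_iff_false, iff_false, not_and, not_le]
        intro hl
        refine lt_of_le_of_lt hs.2 (lt_of_lt_of_le ht ?_)
        exact Finset.single_le_sum (f := d.gap k) (fun i _ => (hpos i).le)
          (Finset.mem_range.2 hl)
      simp [count, this]
    rw [hc]; rfl
  rw [preLevel, intervalIntegral.integral_congr this]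
  simp

/-- On every realization with positive inter-arrival times and no accumulation of arrivals (hence
almost surely), the behavioral switch takes place exactly at the first ruin time. -/
theorem ruinTime_eq_switchTime (hpos : ∀ k ℓ, 0 < d.gap k ℓ)
    (hx : ∀ k, Tendsto (epoch (d.gap k)) atTop atTop) : ruinTime p d = switchTime p d := by
  apply le_antisymm
  · by_cases hT : switchTime p d = ⊤
    · rw [hT]; exact le_top
    set A : Set ℝ := {s : ℝ | 0 < s ∧ ∃ k, preLevel p d k s = 0} with hA
    obtain ⟨m, hm0, hm⟩ : ∃ m : ℝ, 0 < m ∧ ∀ k, m ≤ d.gap k 0 :=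
      ⟨min (d.gap 0 0) (d.gap 1 0), lt_min (hpos 0 0) (hpos 1 0), by
        intro k; fin_cases k <;> simp⟩
    have hAm : ∀ s ∈ A, m ≤ s := by
      rintro s ⟨hs, k, hk⟩
      by_contra h
      rw [pre_small p k (hpos k) hs.le ((not_le.1 h).trans_le (hm k))] at hk
      exact absurd hk (mul_pos hs (p.init_pos k)).ne'
    have hcl : IsClosed A := by
      have : A = Set.Ici m ∩ ⋃ k, {s | preLevel p d k s = 0} := by
        ext s
        constructor
        · intro h; exact ⟨hAm s h, by simpa using h.2⟩
        · intro h; exact ⟨hm0.trans_le h.1, by simpa using h.2⟩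
      rw [this]
      exact isClosed_Ici.inter (isClosed_iUnion_of_finite fun k =>
        isClosed_eq (continuous_pre p k (hx k)) continuous_const)
    have hne : A.Nonempty := by
      by_contra h
      rw [Set.not_nonempty_iff_eq_empty] at h
      exact hT (by rw [switchTime, ← hA, h]; simp)
    have hmem : sInf A ∈ A := hcl.csInf_mem hne ⟨m, hAm⟩
    have hsw : switchTime p d = ((sInf A : ℝ) : EReal) := by
      apply le_antisymm
      · exact sInf_le ⟨_, hmem, rfl⟩
      · refine le_sInf ?_
        rintro _ ⟨s, hs, rfl⟩
        exact EReal.coe_le_coe_iff.2 (csInf_le ⟨m, hAm⟩ hs)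
    rw [hsw]
    refine sInf_le ⟨_, ⟨hmem.1, ?_⟩, rfl⟩
    obtain ⟨k, hk⟩ := hmem.2
    exact ⟨k, by rw [level_eq_pre p d k hmem.1.le hsw.ge, hk]⟩
  · refine le_sInf ?_
    rintro _ ⟨s, ⟨hs, k, hk⟩, rfl⟩
    by_contra h
    rw [level_eq_pre p d k hs.le (not_le.1 h).le] at hk
    exact h (sInf_le ⟨s, ⟨hs, k, hk⟩, rfl⟩)
end Sanity

section Law

variable {E S : Fin 2 → Type*} [∀ k, Fintype (E k)] [∀ k, Fintype (S k)]
  [∀ k, DecidableEq (E k)] [∀ k, DecidableEq (S k)] {Ω : Type*} [MeasurableSpace Ω]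

/-- Labels of the independent sources of randomness. -/
inductive Source
  | gap (k : Fin 2) (ℓ : ℕ)
  | stepE (k : Fin 2) (ℓ : ℕ)
  | stepS (k : Fin 2) (ℓ : ℕ)
  | switch (k : Fin 2)
  | hat (k : Fin 2) (ℓ : ℕ)

/-- The σ-algebra generated by a source of randomness. -/
@[reducible] def sourceSigma (D : Ω → Drive E S) (H : Ω → Fin 2 → ℕ → ℝ) : Source → MeasurableSpace Ω
  | .gap k ℓ => MeasurableSpace.comap (fun ω => (D ω).gap k ℓ) inferInstance
  | .stepE k ℓ => MeasurableSpace.comap (fun ω => (D ω).stepE k ℓ) ⊤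
  | .stepS k ℓ => MeasurableSpace.comap (fun ω => (D ω).stepS k ℓ) ⊤
  | .switch k => MeasurableSpace.comap (fun ω => (D ω).switch k) ⊤
  | .hat k ℓ => MeasurableSpace.comap (fun ω => H ω k ℓ) inferInstance

/-- `D` drives the uniformization construction of the ruin-dependent bivariate fluid process with
parameters `p`, and `H` holds the inter-arrival times of two more Poisson processes, of
intensity `γ - γ₀`; all of these are mutually independent. The `k`-th grid of `D` is a
Poisson process of intensity `γ₀`; at its arrivals a state `i` is replaced by `j` with
probability `(I + A / γ₀) i j`; at the switch it is replaced by `j` with probability `P i j`. -/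
structure IsObservedModel (p : Params E S) (μ : Measure Ω) (γ : ℝ)
    (D : Ω → Drive E S) (H : Ω → Fin 2 → ℕ → ℝ) : Prop where
  measurable : ∀ a, sourceSigma D H a ≤ ‹MeasurableSpace Ω›
  indep : iIndep (sourceSigma D H) μ
  gap_law : ∀ k ℓ, μ.map (fun ω => (D ω).gap k ℓ) = expMeasure p.γ₀
  stepE_law : ∀ k ℓ i j, μ {ω | (D ω).stepE k ℓ i = j} =
    ENNReal.ofReal ((1 + p.γ₀⁻¹ • p.AE k) i j)
  stepS_law : ∀ k ℓ i j, μ {ω | (D ω).stepS k ℓ i = j} =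
    ENNReal.ofReal ((1 + p.γ₀⁻¹ • p.AS k) i j)
  switch_law : ∀ k i j, μ {ω | (D ω).switch k i = j} = ENNReal.ofReal (p.P k i j)
  hat_law : ∀ k ℓ, μ.map (fun ω => H ω k ℓ) = expMeasure (γ - p.γ₀)

end Law

end

end RuinFluid

namespace RuinFluid

/-! ### Exponential tail bounds and the law of large numbers for arrival epochs. -/

section Exponential

variable {Ω : Type*} [MeasurableSpace Ω] {μ : Measure Ω}

/-! Only the added grids depend on γ; the fluid process is fixed. An added grid has intensity γ -
γ₀, so its arrival with index ⌈cγ⌉ lies near c: almost surely, for all rational c > 0 at once, it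
converges to c (`ae_tendsto_epoch_ceil`). Since different γ may depend on each other arbitrarily,
this rests on Chernoff bounds and the first Borel–Cantelli lemma. Superposing the fixed grid shifts
indices by a bounded amount on bounded time intervals, so the limit persists
(`tendsto_superEpoch_ceil`); the law of the superposition is never computed.

The rest is pathwise. Let τ be the ruin time. The detecting condition fails on [0, τ] and holds on a
right neighbourhood of τ, so for rationals 0 < c < τ < c' the detected index eventually lies between
⌈cγ⌉ and ⌈c'γ⌉ (`index_bracket`). Both coordinates' grids have the same asymptotics, so this index,
read on either grid, gives an epoch close to τ (`tendsto_gridAt`). For detection by a negative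
level, the level cannot become negative before τ without first vanishing (`preLevel_pos`), and
right-continuity of the rate makes it decrease linearly just after τ (`exists_rate_eq_right`,
`level_eq_add`). -/

theorem lintegral_exp_mul_expMeasure {r s : ℝ} (hr : 0 < r) (hs : s < r) :
    ∫⁻ x, ENNReal.ofReal (Real.exp (s * x)) ∂(expMeasure r) = ENNReal.ofReal (r / (r - s)) := by
  have hrs : 0 < r - s := sub_pos.2 hs
  have hm : ∀ q, Measurable (exponentialPDF q) := fun q =>
    (measurable_exponentialPDFReal q).ennreal_ofReal
  have h1 : expMeasure r = volume.withDensity (exponentialPDF r) := rfl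
  rw [h1, lintegral_withDensity_eq_lintegral_mul _ (hm r) (by fun_prop)]
  -- Exponential tilting: the weighted density is a multiple of the density of rate r - s.
  have h2 : ∀ x, (exponentialPDF r * fun x => ENNReal.ofReal (Real.exp (s * x))) x
      = ENNReal.ofReal (r / (r - s)) * exponentialPDF (r - s) x := by
    intro x
    rw [Pi.mul_apply]
    rcases lt_or_ge x 0 with hx | hx
    · simp [exponentialPDF_of_neg hx]
    · rw [exponentialPDF_of_nonneg hx, exponentialPDF_of_nonneg hx,
        ← ENNReal.ofReal_mul (by positivity), ← ENNReal.ofReal_mul (by positivity)]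
      congr 1
      rw [mul_assoc, ← Real.exp_add, ← mul_assoc, div_mul_cancel₀ _ hrs.ne']
      ring_nf
  simp_rw [h2]
  rw [lintegral_const_mul _ (hm _), lintegral_exponentialPDF_eq_one hrs, mul_one]

theorem lintegral_exp_mul_of_map_eq_expMeasure {X : Ω → ℝ} (hX : Measurable X) {r s : ℝ}
    (hr : 0 < r) (hs : s < r) (hlaw : μ.map X = expMeasure r) :
    ∫⁻ ω, ENNReal.ofReal (Real.exp (s * X ω)) ∂μ = ENNReal.ofReal (r / (r - s)) := by
  rw [← lintegral_exp_mul_expMeasure hr hs, ← hlaw, lintegral_map (by fun_prop) hX]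

theorem integrable_exp_mul_of_map_eq_expMeasure {X : Ω → ℝ} (hX : Measurable X) {r s : ℝ}
    (hr : 0 < r) (hs : s < r) (hlaw : μ.map X = expMeasure r) :
    Integrable (fun ω => Real.exp (s * X ω)) μ := by
  refine ⟨by fun_prop, ?_⟩
  rw [hasFiniteIntegral_iff_ofReal (Eventually.of_forall fun _ => (Real.exp_pos _).le),
    lintegral_exp_mul_of_map_eq_expMeasure hX hr hs hlaw]
  exact ENNReal.ofReal_lt_top

theorem mgf_of_map_eq_expMeasure {X : Ω → ℝ} (hX : Measurable X) {r s : ℝ}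
    (hr : 0 < r) (hs : s < r) (hlaw : μ.map X = expMeasure r) : mgf X μ s = r / (r - s) := by
  rw [mgf, integral_eq_lintegral_of_nonneg_ae (Eventually.of_forall fun _ => (Real.exp_pos _).le)
    (by fun_prop), lintegral_exp_mul_of_map_eq_expMeasure hX hr hs hlaw,
    ENNReal.toReal_ofReal (div_nonneg hr.le (sub_pos.2 hs).le)]

theorem ae_pos_of_map_eq_expMeasure {X : Ω → ℝ} (hX : Measurable X) {r : ℝ}
    (hr : 0 < r) (hlaw : μ.map X = expMeasure r) : ∀ᵐ ω ∂μ, 0 < X ω := by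
  have h0 : expMeasure r (Set.Iic 0) = 0 := by
    have h1 : expMeasure r = volume.withDensity (exponentialPDF r) := rfl
    rw [h1, withDensity_apply _ measurableSet_Iic, lintegral_exponentialPDF_eq_antiDeriv hr]
    simp
  rw [← hlaw, Measure.map_apply hX measurableSet_Iic] at h0
  rw [ae_iff]
  simpa [Set.preimage, not_lt] using h0

/-- A sequence of independent random variables with the exponential distribution of rate `r`. -/
structure IsPoissonGaps (μ : Measure Ω) (r : ℝ) (X : Ω → ℕ → ℝ) : Prop where
  measurable : ∀ ℓ, Measurable fun ω => X ω ℓ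
  indep : iIndepFun (fun ℓ ω => X ω ℓ) μ
  law : ∀ ℓ, μ.map (fun ω => X ω ℓ) = expMeasure r

namespace IsPoissonGaps

variable {r : ℝ} {X : Ω → ℕ → ℝ}

theorem ae_pos (h : IsPoissonGaps μ r X) (hr : 0 < r) : ∀ᵐ ω ∂μ, ∀ ℓ, 0 < X ω ℓ :=
  ae_all_iff.2 fun ℓ => ae_pos_of_map_eq_expMeasure (h.measurable ℓ) hr (h.law ℓ)

theorem mgf_epoch (h : IsPoissonGaps μ r X) (hr : 0 < r) {s : ℝ} (hs : s < r)
    (m : ℕ) : mgf (fun ω => epoch (X ω) m) μ s = (r / (r - s)) ^ m := by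
  have he : (fun ω => epoch (X ω) m) = ∑ i ∈ Finset.range m, fun ω => X ω i := by
    ext ω; simp [epoch]
  rw [he, h.indep.mgf_sum h.measurable, Finset.prod_congr rfl fun i _ =>
    mgf_of_map_eq_expMeasure (h.measurable i) hr hs (h.law i)]
  simp [div_pow]

theorem integrable_exp_mul_epoch [IsFiniteMeasure μ] (h : IsPoissonGaps μ r X) (hr : 0 < r)
    {s : ℝ} (hs : s < r) (m : ℕ) : Integrable (fun ω => Real.exp (s * epoch (X ω) m)) μ := by
  have := h.indep.integrable_exp_mul_sum (t := s) (s := Finset.range m) h.measurable fun i _ =>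
    integrable_exp_mul_of_map_eq_expMeasure (h.measurable i) hr hs (h.law i)
  simpa [epoch] using this

/-- Chernoff's bound with tilt r * u. Measuring the tilt as a fraction of the rate makes each gap
contribute 1 / (1 - u) = 1 + u / (1 - u) ≤ exp (u / (1 - u)), which does not involve r. -/
theorem measure_le_epoch_le [IsFiniteMeasure μ] (h : IsPoissonGaps μ r X) (hr : 0 < r)
    {u : ℝ} (hu : 0 ≤ u) (hu1 : u < 1) (t : ℝ) (m : ℕ) :
    μ {ω | t ≤ epoch (X ω) m} ≤ ENNReal.ofReal (Real.exp (-(r * u * t) + m * (u / (1 - u)))) := by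
  have hs : r * u < r := by nlinarith
  have h1 : (0 : ℝ) < 1 - u := sub_pos.2 hu1
  have := measure_ge_le_exp_mul_mgf (X := fun ω => epoch (X ω) m) (μ := μ) t
    (mul_nonneg hr.le hu) (h.integrable_exp_mul_epoch hr hs m)
  rw [h.mgf_epoch hr hs] at this
  rw [← ofReal_measureReal]
  refine ENNReal.ofReal_le_ofReal (this.trans ?_)
  rw [Real.exp_add, Real.exp_nat_mul, neg_mul]
  refine mul_le_mul_of_nonneg_left (pow_le_pow_left₀ ?_ ?_ m) (Real.exp_pos _).le
  · exact div_nonneg hr.le (sub_pos.2 hs).le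
  · refine le_trans (le_of_eq ?_) (Real.add_one_le_exp _)
    have : r - r * u = r * (1 - u) := by ring
    rw [this]
    field_simp
    ring

/-- The same with tilt -(r * u), where 1 / (1 + u) = 1 - u / (1 + u) ≤ exp (-(u / (1 + u))). -/
theorem measure_epoch_le_le [IsFiniteMeasure μ] (h : IsPoissonGaps μ r X) (hr : 0 < r)
    {u : ℝ} (hu : 0 ≤ u) (t : ℝ) (m : ℕ) :
    μ {ω | epoch (X ω) m ≤ t} ≤ ENNReal.ofReal (Real.exp (r * u * t - m * (u / (1 + u)))) := by
  have hs : -(r * u) < r := by nlinarith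
  have := measure_le_le_exp_mul_mgf (X := fun ω => epoch (X ω) m) (μ := μ) t
    (neg_nonpos.2 (mul_nonneg hr.le hu)) (h.integrable_exp_mul_epoch hr hs m)
  rw [h.mgf_epoch hr hs] at this
  rw [← ofReal_measureReal]
  refine ENNReal.ofReal_le_ofReal (this.trans ?_)
  rw [sub_eq_add_neg (r * u * t), ← mul_neg (m : ℝ), Real.exp_add, Real.exp_nat_mul, neg_neg]
  refine mul_le_mul_of_nonneg_left (pow_le_pow_left₀ ?_ ?_ m) (Real.exp_pos _).le
  · exact div_nonneg hr.le (sub_pos.2 hs).le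
  · refine le_trans (le_of_eq ?_) (Real.add_one_le_exp _)
    have : r - -(r * u) = r * (1 + u) := by ring
    rw [this]
    field_simp
    ring

end IsPoissonGaps

/-- First Borel–Cantelli lemma with a geometric series; no independence between the events is
required. -/
theorem ae_eventually_notMem_of_le_exp {s : ℕ → Set Ω} {K δ : ℝ} (hδ : 0 < δ)
    (h : ∀ n, μ (s n) ≤ ENNReal.ofReal (Real.exp (K + n * -δ))) :
    ∀ᵐ ω ∂μ, ∀ᶠ n in atTop, ω ∉ s n := by
  refine ae_eventually_notMem (ne_top_of_le_ne_top ?_ (ENNReal.tsum_le_tsum h))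
  simp_rw [Real.exp_add]
  exact ((Real.summable_exp_nat_mul_iff.2 (neg_lt_zero.2 hδ)).mul_left _).tsum_ofReal_ne_top

theorem IsPoissonGaps.ae_tendsto_epoch_atTop [IsFiniteMeasure μ] {r : ℝ} {X : Ω → ℕ → ℝ}
    (h : IsPoissonGaps μ r X) (hr : 0 < r) : ∀ᵐ ω ∂μ, Tendsto (epoch (X ω)) atTop atTop := by
  have key : ∀ N : ℕ, ∀ᵐ ω ∂μ, ∀ᶠ m in atTop, ω ∉ {ω | epoch (X ω) m ≤ N} := fun N => by
    -- The tilt is u = 1, for which u / (1 + u) = 1 / 2.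
    refine ae_eventually_notMem_of_le_exp (K := r * 1 * N) (δ := 1 / 2) (by norm_num) fun m =>
      (h.measure_epoch_le_le hr zero_le_one N m).trans (le_of_eq ?_)
    congr 2
    ring
  filter_upwards [ae_all_iff.2 key] with ω hω
  refine tendsto_atTop.2 fun b => ?_
  obtain ⟨N, hN⟩ := exists_nat_ge b
  filter_upwards [hω N] with m hm
  exact hN.trans (not_le.1 hm).le

/-- The epoch with index `⌈c * n⌉₊` of a Poisson process of intensity `n - a` converges to `c`
as `n → ∞`, whatever the dependence between the processes for different `n`. -/
theorem ae_tendsto_epoch_ceil [IsFiniteMeasure μ] {a : ℝ} {X : ℕ → Ω → ℕ → ℝ}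
    (h : ∀ n : ℕ, a < n → IsPoissonGaps μ (n - a) (X n)) {c : ℝ} (hc : 0 < c) :
    ∀ᵐ ω ∂μ, Tendsto (fun n : ℕ => epoch (X n ω) ⌈c * n⌉₊) atTop (𝓝 c) := by
  have ha : ∀ᶠ n : ℕ in atTop, a < n := tendsto_natCast_atTop_atTop.eventually_gt_atTop a
  -- Rational thresholds keep the union of exceptional null sets countable.
  have hub : ∀ t : ℚ, ∀ᵐ ω ∂μ, c < t → ∀ᶠ n : ℕ in atTop, epoch (X n ω) ⌈c * n⌉₊ < t := by
    intro t
    by_cases ht : c < t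
    swap
    · exact Eventually.of_forall fun ω h => absurd h ht
    have ht0 : (0 : ℝ) < t := hc.trans ht
    -- The exponent has negative slope in n exactly when c < t * (1 - u); this u makes t * (1 - u)
    -- the midpoint of c and t.
    set u : ℝ := (t - c) / (2 * t) with hu
    have hu0 : 0 < u := div_pos (sub_pos.2 ht) (by positivity)
    have h1u : 1 - u = (t + c) / (2 * t) := by rw [hu]; field_simp; ring
    have hu1 : 0 < 1 - u := by rw [h1u]; positivity
    have hδ : 0 < u * t - c * (u / (1 - u)) := by
      have : u * t - c * (u / (1 - u)) = u * (t * (t - c) / (t + c)) := by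
        rw [h1u]; field_simp; ring
      rw [this]
      have := sub_pos.2 ht
      positivity
    have := ae_eventually_notMem_of_le_exp (μ := μ)
      -- The conjunct `a < n` empties the events for which no law is prescribed. The constant `K`
      -- absorbs the shift of the intensity by a and the rounding of the index.
      (s := fun n => {ω | a < n ∧ (t : ℝ) ≤ epoch (X n ω) ⌈c * n⌉₊})
      (K := a * u * t + u / (1 - u)) hδ fun n => by
        by_cases han : a < n
        · simp only [han, true_and]
          refine ((h n han).measure_le_epoch_le (sub_pos.2 han) hu0.le (by linarith) _ _).trans ?_
          refine ENNReal.ofReal_le_ofReal (Real.exp_le_exp.2 ?_)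
          have h2 : (⌈c * n⌉₊ : ℝ) ≤ c * n + 1 := (Nat.ceil_lt_add_one (by positivity)).le
          have h3 := mul_le_mul_of_nonneg_right h2 (div_pos hu0 hu1).le
          linarith
        · simp [han]
    filter_upwards [this] with ω hω _
    filter_upwards [hω, ha] with n hn han
    exact not_le.1 fun h => hn ⟨han, h⟩
  have hlb : ∀ t : ℚ, ∀ᵐ ω ∂μ, (0 : ℝ) < t → t < c →
      ∀ᶠ n : ℕ in atTop, t < epoch (X n ω) ⌈c * n⌉₊ := by
    intro t
    by_cases ht : (0 : ℝ) < t ∧ t < c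
    swap
    · exact Eventually.of_forall fun ω h0 h1 => absurd ⟨h0, h1⟩ ht
    obtain ⟨ht0, ht⟩ := ht
    -- Now t * (1 + u) < c is needed, and t * (1 + u) is again the midpoint.
    set u : ℝ := (c - t) / (2 * t) with hu
    have hu0 : 0 < u := div_pos (sub_pos.2 ht) (by positivity)
    have h1u : 1 + u = (t + c) / (2 * t) := by rw [hu]; field_simp; ring
    have hδ : 0 < c * (u / (1 + u)) - u * t := by
      have : c * (u / (1 + u)) - u * t = u * (t * (c - t) / (t + c)) := by
        rw [h1u]; field_simp; ring
      rw [this]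
      have := sub_pos.2 ht
      positivity
    have := ae_eventually_notMem_of_le_exp (μ := μ)
      (s := fun n => {ω | a < n ∧ epoch (X n ω) ⌈c * n⌉₊ ≤ t})
      (K := -(a * u * t)) hδ fun n => by
        by_cases han : a < n
        · simp only [han, true_and]
          refine ((h n han).measure_epoch_le_le (sub_pos.2 han) hu0.le _ _).trans ?_
          refine ENNReal.ofReal_le_ofReal (Real.exp_le_exp.2 ?_)
          have h3 := mul_le_mul_of_nonneg_right (Nat.le_ceil (c * (n : ℝ)))
            (div_nonneg hu0.le (by linarith) : 0 ≤ u / (1 + u))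
          linarith
        · simp [han]
    filter_upwards [this] with ω hω _ _
    filter_upwards [hω, ha] with n hn han
    exact not_le.1 fun h => hn ⟨han, h⟩
  filter_upwards [ae_all_iff.2 hub, ae_all_iff.2 hlb] with ω hω1 hω2
  refine tendsto_order.2 ⟨fun b hb => ?_, fun b hb => ?_⟩
  · obtain ⟨t, ht1, ht2⟩ := exists_rat_btwn (max_lt hb hc)
    filter_upwards [hω2 t ((le_max_right _ _).trans_lt ht1) ht2] with n hn
    exact ((le_max_left _ _).trans_lt ht1).trans hn
  · obtain ⟨t, ht1, ht2⟩ := exists_rat_btwn hb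
    filter_upwards [hω1 t ht1] with n hn
    exact hn.trans ht2

end Exponential
-- Epochs and counting functions of a single point process.
section Epochs

theorem epoch_mono {x : ℕ → ℝ} (h : ∀ ℓ, 0 ≤ x ℓ) : Monotone (epoch x) := fun _ _ hmn =>
  Finset.sum_le_sum_of_subset_of_nonneg (Finset.range_mono hmn) fun i _ _ => h i

theorem le_count_of_epoch_le {x : ℕ → ℝ} (h : ∀ ℓ, 0 ≤ x ℓ)
    (hx : Tendsto (epoch x) atTop atTop) {m : ℕ} {t : ℝ} (hm : epoch x m ≤ t) :
    m ≤ count x t := by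
  have hsub : (Finset.Icc 1 m : Set ℕ) ⊆ {ℓ : ℕ | 1 ≤ ℓ ∧ epoch x ℓ ≤ t} := fun ℓ hℓ => by
    rw [Finset.coe_Icc] at hℓ
    exact ⟨hℓ.1, (epoch_mono h hℓ.2).trans hm⟩
  have := Set.ncard_le_ncard hsub (finite_count hx t)
  rwa [Set.ncard_coe_finset, Nat.card_Icc, Nat.add_sub_cancel] at this

theorem count_lt_of_lt_epoch {x : ℕ → ℝ} (h : ∀ ℓ, 0 ≤ x ℓ) {m : ℕ} {t : ℝ} (hm0 : 0 < m)
    (hm : t < epoch x m) : count x t < m := by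
  have hsub : {ℓ : ℕ | 1 ≤ ℓ ∧ epoch x ℓ ≤ t} ⊆ (Finset.Icc 1 (m - 1) : Set ℕ) := fun ℓ hℓ => by
    rw [Finset.coe_Icc]
    refine ⟨hℓ.1, Nat.le_sub_one_of_lt ?_⟩
    by_contra hlt
    exact absurd ((epoch_mono h (not_lt.1 hlt)).trans hℓ.2) (not_le.2 hm)
  have := Set.ncard_le_ncard hsub (Finset.finite_toSet _)
  rw [Set.ncard_coe_finset, Nat.card_Icc, Nat.add_sub_cancel] at this
  unfold count
  omega

/-- The counting function of a point process without accumulation points is right-continuous. -/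
theorem exists_count_eq_right {x : ℕ → ℝ} (hx : Tendsto (epoch x) atTop atTop) (t : ℝ) :
    ∃ δ > 0, ∀ s, t ≤ s → s < t + δ → count x s = count x t := by
  have hfin := (finite_count hx (t + 1)).subset
    (show {ℓ : ℕ | (1 ≤ ℓ ∧ epoch x ℓ ≤ t + 1) ∧ t < epoch x ℓ} ⊆ _ from fun ℓ h => h.1)
  -- Only the finitely many epochs in (t, t + 1] could change the count, and s near t stays below
  -- all of them.
  have hev : ∀ᶠ s in 𝓝 t, ∀ ℓ ∈ {ℓ : ℕ | (1 ≤ ℓ ∧ epoch x ℓ ≤ t + 1) ∧ t < epoch x ℓ},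
      s < epoch x ℓ :=
    (eventually_all_finite hfin).2 fun ℓ hℓ => eventually_lt_nhds hℓ.2
  obtain ⟨δ, hδ, hball⟩ := Metric.eventually_nhds_iff.1 hev
  refine ⟨min δ 1, lt_min hδ one_pos, fun s hts hs => ?_⟩
  unfold count
  congr 1
  ext ℓ
  refine ⟨fun h => ⟨h.1, ?_⟩, fun h => ⟨h.1, h.2.trans hts⟩⟩
  by_contra hlt
  have h1 := min_le_left δ 1
  have h2 := min_le_right δ 1
  refine absurd h.2 (not_le.2 (hball ?_ ℓ ⟨⟨h.1, h.2.trans (by linarith)⟩, not_le.1 hlt⟩))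
  rw [Real.dist_eq, abs_of_nonneg (by linarith)]
  linarith

end Epochs

/-! ### Superposition with a fixed point process. -/

section Superposition

variable {x y : ℕ → ℝ}

theorem superEpoch_le {ℓ : ℕ} {t : ℝ} (ht : 0 ≤ t) (h : ℓ ≤ count x t + count y t) :
    superEpoch x y ℓ ≤ t :=
  csInf_le ⟨0, fun _ hs => hs.1⟩ ⟨ht, h⟩

/-- Extra points can only bring the arrival of a given index forward. -/
theorem superEpoch_le_epoch (hy0 : ∀ ℓ, 0 ≤ y ℓ) (hy : Tendsto (epoch y) atTop atTop) (ℓ : ℕ) :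
    superEpoch x y ℓ ≤ epoch y ℓ :=
  superEpoch_le (Finset.sum_nonneg fun i _ => hy0 i)
    ((le_count_of_epoch_le hy0 hy le_rfl).trans (Nat.le_add_left _ _))

theorem superEpoch_set_nonempty (hy0 : ∀ ℓ, 0 ≤ y ℓ) (hy : Tendsto (epoch y) atTop atTop)
    (ℓ : ℕ) : {t : ℝ | 0 ≤ t ∧ ℓ ≤ count x t + count y t}.Nonempty :=
  ⟨epoch y ℓ, Finset.sum_nonneg fun i _ => hy0 i,
    (le_count_of_epoch_le hy0 hy le_rfl).trans (Nat.le_add_left _ _)⟩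

theorem superEpoch_mono (hy0 : ∀ ℓ, 0 ≤ y ℓ) (hy : Tendsto (epoch y) atTop atTop) :
    Monotone (superEpoch x y) := fun _ n hmn =>
  csInf_le_csInf ⟨0, fun _ hs => hs.1⟩ (superEpoch_set_nonempty hy0 hy n)
    fun _ ht => ⟨ht.1, hmn.trans ht.2⟩

theorem superEpoch_nonneg (ℓ : ℕ) : 0 ≤ superEpoch x y ℓ := Real.sInf_nonneg fun _ ht => ht.1

theorem le_superEpoch (hx : Tendsto (epoch x) atTop atTop) (hy0 : ∀ ℓ, 0 ≤ y ℓ)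
    (hy : Tendsto (epoch y) atTop atTop) {ℓ : ℕ} {t : ℝ} (h : count x t + count y t < ℓ) :
    t ≤ superEpoch x y ℓ :=
  le_csInf (superEpoch_set_nonempty hy0 hy ℓ) fun s hs => by
    by_contra hst
    have h1 := count_mono hx (not_le.1 hst).le
    have h2 := count_mono hy (not_le.1 hst).le
    have := hs.2
    omega

/-- Superposing a fixed point process does not affect the macroscopic position of the epochs of a
sequence of point processes of increasing intensity. -/
theorem tendsto_superEpoch_ceil (hx : Tendsto (epoch x) atTop atTop) {z : ℕ → ℕ → ℝ}
    (hz0 : ∀ᶠ n in atTop, ∀ ℓ, 0 ≤ z n ℓ) (hz : ∀ᶠ n in atTop, Tendsto (epoch (z n)) atTop atTop)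
    (hlim : ∀ c : ℚ, 0 < c → Tendsto (fun n : ℕ => epoch (z n) ⌈(c : ℝ) * n⌉₊) atTop (𝓝 c))
    {c : ℚ} (hc : 0 < c) :
    Tendsto (fun n : ℕ => superEpoch x (z n) ⌈(c : ℝ) * n⌉₊) atTop (𝓝 c) := by
  refine tendsto_order.2 ⟨fun a ha => ?_, fun b hb => ?_⟩
  -- With a < t < c₁ < c, the process `z n` has fewer than ⌈c₁ n⌉ points up to t. The fixed number
  -- of points of `x` up to t fits into the slack (c - c₁) n, so index ⌈c n⌉ is not reached by time
  -- t.
  · obtain ⟨c₁, h1, h2⟩ := exists_rat_btwn (max_lt ha (Rat.cast_pos.2 hc : (0 : ℝ) < c))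
    have hc₁ : (0 : ℝ) < c₁ := (le_max_right _ _).trans_lt h1
    obtain ⟨t, hat, ht⟩ := exists_between ((le_max_left _ _).trans_lt h1)
    have hgap : ∀ᶠ n : ℕ in atTop, (count x t : ℝ) + 1 ≤ ((c : ℝ) - c₁) * n :=
      (tendsto_natCast_atTop_atTop.const_mul_atTop (sub_pos.2 h2)).eventually_ge_atTop _
    filter_upwards [hz0, hz, hgap, (hlim c₁ (Rat.cast_pos.1 hc₁)).eventually_const_lt ht,
      eventually_gt_atTop 0] with n hn0 hn hng hnt hnpos
    refine hat.trans_le (le_superEpoch hx hn0 hn ?_)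
    have hnR : (0 : ℝ) < n := Nat.cast_pos.2 hnpos
    have h3 := count_lt_of_lt_epoch hn0 (Nat.ceil_pos.2 (mul_pos hc₁ hnR)) hnt
    have h4 : (⌈(c₁ : ℝ) * n⌉₊ : ℝ) < c₁ * n + 1 := Nat.ceil_lt_add_one (by positivity)
    have h5 : (c : ℝ) * n ≤ ⌈(c : ℝ) * n⌉₊ := Nat.le_ceil _
    have h6 : (count (z n) t : ℝ) < ⌈(c₁ : ℝ) * n⌉₊ := Nat.cast_lt.2 h3
    have h7 : ((count x t + count (z n) t : ℕ) : ℝ) < ⌈(c : ℝ) * n⌉₊ := by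
      push_cast
      linarith
    exact_mod_cast h7
  · filter_upwards [hz0, hz, (hlim c hc).eventually_lt_const hb] with n hn0 hn hnb
    exact (superEpoch_le_epoch hn0 hn _).trans_lt hnb

end Superposition

/-! ### From regular grids to first-detection indices. -/

/-- The first index at which a grid satisfies `Q` is asymptotically `τ * n`, if `Q` fails up to
`τ` and holds immediately after `τ`. -/
theorem index_bracket {g : ℕ → ℕ → ℝ} {τ : ℝ} (hτ : 0 < τ)
    (hmono : ∀ᶠ n in atTop, Monotone (g n)) (hg0 : ∀ n ℓ, 0 ≤ g n ℓ)
    (hlim : ∀ c : ℚ, 0 < c → Tendsto (fun n : ℕ => g n ⌈(c : ℝ) * n⌉₊) atTop (𝓝 c))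
    {Q : ℝ → Prop} (hQ : ∀ t, 0 ≤ t → t ≤ τ → ¬ Q t)
    {δ : ℝ} (hδ : 0 < δ) (hQ' : ∀ t, τ < t → t < τ + δ → Q t) :
    (∀ c : ℚ, 0 < c → (c : ℝ) < τ → ∀ᶠ n : ℕ in atTop, (⌈(c : ℝ) * n⌉₊ : ℕ∞) ≤
      sInf ((fun ℓ : ℕ => (ℓ : ℕ∞)) '' {ℓ : ℕ | 1 ≤ ℓ ∧ Q (g n ℓ)})) ∧
    (∀ c : ℚ, τ < c → ∀ᶠ n : ℕ in atTop,
      sInf ((fun ℓ : ℕ => (ℓ : ℕ∞)) '' {ℓ : ℕ | 1 ≤ ℓ ∧ Q (g n ℓ)}) ≤ (⌈(c : ℝ) * n⌉₊ : ℕ∞)) := by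
  refine ⟨fun c hc hcτ => ?_, fun c hc => ?_⟩
  · filter_upwards [hmono, (hlim c hc).eventually_lt_const hcτ] with n hn ht
    refine le_sInf ?_
    rintro _ ⟨ℓ, ⟨_, hℓ⟩, rfl⟩
    refine Nat.cast_le.2 (not_lt.1 fun hlt => ?_)
    exact hQ _ (hg0 n ℓ) ((hn hlt.le).trans ht.le) hℓ
  -- The epoch of index ⌈c' n⌉ eventually lands in (τ, τ + δ), so this index satisfies `Q` and
  -- bounds the infimum.
  · obtain ⟨c', h1, h2⟩ := exists_rat_btwn (lt_min hc (lt_add_of_pos_right τ hδ))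
    have hc'τ : (0 : ℝ) < c' := hτ.trans h1
    have hc' : 0 < c' := by exact_mod_cast hc'τ
    filter_upwards [(hlim c' hc').eventually_const_lt h1,
      (hlim c' hc').eventually_lt_const (h2.trans_le (min_le_right _ _)),
      eventually_gt_atTop 0] with n hn1 hn2 hn
    have hnR : (0 : ℝ) < n := Nat.cast_pos.2 hn
    have hmem : ⌈(c' : ℝ) * n⌉₊ ∈ {ℓ : ℕ | 1 ≤ ℓ ∧ Q (g n ℓ)} :=
      ⟨Nat.ceil_pos.2 (mul_pos hc'τ hnR), hQ' _ hn1 hn2⟩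
    refine (sInf_le (Set.mem_image_of_mem (fun ℓ : ℕ => (ℓ : ℕ∞)) hmem)).trans
      (Nat.cast_le.2 (Nat.ceil_mono ?_))
    exact mul_le_mul_of_nonneg_right (h2.trans_le (min_le_left _ _)).le hnR.le

section Path

variable {E S : Fin 2 → Type*} [∀ k, Fintype (E k)] [∀ k, Fintype (S k)]
  (p : Params E S) (d : Drive E S)

/-- Monotonicity of the grid turns the bracket on the index into one on the epoch. The bracket may
come from the other coordinate's grid, which is how the observation of [1] locates the switch of
[2]. -/
theorem tendsto_gridAt {h : ℕ → Fin 2 → ℕ → ℝ} {j : Fin 2} {τ : ℝ} (hτ : 0 < τ)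
    (hmono : ∀ᶠ n in atTop, Monotone (grid d (h n) (order p d j)))
    (hlim : ∀ c : ℚ, 0 < c →
      Tendsto (fun n : ℕ => grid d (h n) (order p d j) ⌈(c : ℝ) * n⌉₊) atTop (𝓝 c))
    {L : ℕ → ℕ∞}
    (hlow : ∀ c : ℚ, 0 < c → (c : ℝ) < τ → ∀ᶠ n : ℕ in atTop, (⌈(c : ℝ) * n⌉₊ : ℕ∞) ≤ L n)
    (hup : ∀ c : ℚ, τ < c → ∀ᶠ n : ℕ in atTop, L n ≤ (⌈(c : ℝ) * n⌉₊ : ℕ∞)) :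
    Tendsto (fun n => gridAt p d (h n) j (L n)) atTop (𝓝 (τ : EReal)) := by
  refine tendsto_order.2 ⟨fun a ha => ?_, fun b hb => ?_⟩
  · obtain ⟨a', ha', haτ⟩ := EReal.lt_iff_exists_real_btwn.1 ha
    obtain ⟨c, h1, h2⟩ := exists_rat_btwn (max_lt (EReal.coe_lt_coe_iff.1 haτ) hτ)
    have hc : 0 < c := by exact_mod_cast (le_max_right _ _).trans_lt h1
    filter_upwards [hmono, hlow c hc h2,
      (hlim c hc).eventually_const_lt ((le_max_left _ _).trans_lt h1)] with n hn hL ht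
    refine ha'.trans ?_
    generalize L n = l at hL
    induction l using ENat.recTopCoe with
    | top => exact EReal.coe_lt_top a'
    | coe l => exact EReal.coe_lt_coe_iff.2 (ht.trans_le (hn (Nat.cast_le.1 hL)))
  · obtain ⟨b', hτb, hb'⟩ := EReal.lt_iff_exists_real_btwn.1 hb
    obtain ⟨c, h1, h2⟩ := exists_rat_btwn (EReal.coe_lt_coe_iff.1 hτb)
    have hc : 0 < c := by exact_mod_cast hτ.trans h1
    filter_upwards [hmono, hup c h1, (hlim c hc).eventually_lt_const h2] with n hn hL ht
    refine lt_trans ?_ hb'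
    -- The upper bracket also excludes an infinite index.
    generalize L n = l at hL
    induction l using ENat.recTopCoe with
    | top => exact absurd hL (by simp)
    | coe l => exact EReal.coe_lt_coe_iff.2 ((hn (Nat.cast_le.1 hL)).trans_lt ht)

/-! ### Behaviour of the levels around the ruin time. -/

section Ruin

variable {d}

/-- A finite switching time is positive, and a level process vanishes then. -/
theorem exists_switchTime_eq (hpos : ∀ k ℓ, 0 < d.gap k ℓ)
    (hx : ∀ k, Tendsto (epoch (d.gap k)) atTop atTop) (hT : switchTime p d < ⊤) :
    ∃ τ : ℝ, 0 < τ ∧ switchTime p d = τ ∧ (∃ k, preLevel p d k τ = 0) ∧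
      ∀ s, 0 < s → s < τ → ∀ k, preLevel p d k s ≠ 0 := by
  set A : Set ℝ := {s : ℝ | 0 < s ∧ ∃ k, preLevel p d k s = 0} with hA
  obtain ⟨m, hm0, hm⟩ : ∃ m : ℝ, 0 < m ∧ ∀ k, m ≤ d.gap k 0 :=
    ⟨min (d.gap 0 0) (d.gap 1 0), lt_min (hpos 0 0) (hpos 1 0), by
      intro k; fin_cases k <;> simp⟩
  have hAm : ∀ s ∈ A, m ≤ s := by
    rintro s ⟨hs, k, hk⟩
    by_contra h
    rw [pre_small p k (hpos k) hs.le ((not_le.1 h).trans_le (hm k))] at hk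
    exact absurd hk (mul_pos hs (p.init_pos k)).ne'
  have hcl : IsClosed A := by
    have : A = Set.Ici m ∩ ⋃ k, {s | preLevel p d k s = 0} := by
      ext s
      constructor
      · intro h; exact ⟨hAm s h, by simpa using h.2⟩
      · intro h; exact ⟨hm0.trans_le h.1, by simpa using h.2⟩
    rw [this]
    exact isClosed_Ici.inter (isClosed_iUnion_of_finite fun k =>
      isClosed_eq (continuous_pre p k (hx k)) continuous_const)
  have hne : A.Nonempty := by
    by_contra h
    rw [Set.not_nonempty_iff_eq_empty] at h
    exact hT.ne (by rw [switchTime, ← hA, h]; simp)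
  have hmem : sInf A ∈ A := hcl.csInf_mem hne ⟨m, hAm⟩
  refine ⟨sInf A, hmem.1, le_antisymm (sInf_le ⟨_, hmem, rfl⟩) (le_sInf ?_), hmem.2,
    fun s hs hsτ k hk => absurd (csInf_le ⟨m, hAm⟩ ⟨hs, k, hk⟩) (not_le.2 hsτ)⟩
  rintro _ ⟨s, hs, rfl⟩
  exact EReal.coe_le_coe_iff.2 (csInf_le ⟨m, hAm⟩ hs)

theorem level_order_zero {τ : ℝ} (hτ : ruinTime p d = τ) (h : ∃ k, level p d k τ = 0) :
    level p d (order p d 0) τ = 0 := by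
  unfold order
  rw [hτ, EReal.toReal_coe]
  split_ifs with h0
  · exact h0
  · obtain ⟨k, hk⟩ := h
    fin_cases k
    · exact absurd hk h0
    · exact hk

/-- The initial rate is positive, so the level is positive before the first arrival; a later
nonpositive value would force an earlier zero by the intermediate value theorem. -/
theorem preLevel_pos (k : Fin 2) (hpos : ∀ ℓ, 0 < d.gap k ℓ)
    (hx : Tendsto (epoch (d.gap k)) atTop atTop) {τ : ℝ}
    (hne : ∀ s, 0 < s → s < τ → preLevel p d k s ≠ 0) {t : ℝ} (ht : 0 < t) (htτ : t < τ) :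
    0 < preLevel p d k t := by
  by_contra hle
  obtain ⟨s, hs0, hs⟩ := exists_between (lt_min ht (hpos 0))
  have hsp : 0 < preLevel p d k s := by
    rw [pre_small p k hpos hs0.le (hs.trans_le (min_le_right _ _))]
    exact mul_pos hs0 (p.init_pos k)
  have hst : s ≤ t := (hs.trans_le (min_le_left _ _)).le
  obtain ⟨v, hv, hv0⟩ := intermediate_value_Icc' hst (continuous_pre p k hx).continuousOn
    ⟨not_lt.1 hle, hsp.le⟩
  exact hne v (hs0.trans_le hv.1) (hv.2.trans_lt htτ) hv0

/-- The rate is right-continuous at the switch. -/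
theorem exists_rate_eq_right (k : Fin 2) (hx : Tendsto (epoch (d.gap k)) atTop atTop) {τ : ℝ}
    (hτ : switchTime p d = τ) :
    ∃ δ > 0, ∀ s, τ ≤ s → s < τ + δ → rate p d k s = rate p d k τ := by
  obtain ⟨δ, hδ, h⟩ := exists_count_eq_right hx τ
  refine ⟨δ, hδ, fun s h1 h2 => ?_⟩
  have hs : ¬ ((s : EReal) < switchTime p d) := by
    rw [hτ, EReal.coe_lt_coe_iff]
    exact not_lt.2 h1
  have ht : ¬ ((τ : EReal) < switchTime p d) := by rw [hτ]; exact lt_irrefl _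
  rw [rate, rate, env, env, if_neg hs, if_neg ht, hτ, EReal.toReal_coe, h s h1 h2]

theorem level_eq_add (k : Fin 2) (hx : Tendsto (epoch (d.gap k)) atTop atTop) {τ t : ℝ}
    (h0 : 0 ≤ τ) (hτ : switchTime p d = τ) (ht : τ ≤ t)
    (hrate : ∀ s, τ ≤ s → s ≤ t → rate p d k s = rate p d k τ) :
    level p d k t = level p d k τ + (t - τ) * rate p d k τ := by
  -- Splitting the integral at τ needs integrability on both sides; up to τ the rate agrees with the
  -- pre-switch rate except at the point τ.
  have hpre : IntervalIntegrable (rate p d k) volume 0 τ := by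
    refine (intble_pre p k hx 0 τ).congr_ae ?_
    have hne : ∀ᵐ s : ℝ ∂volume, s ≠ τ := by simp [ae_iff]
    refine (ae_restrict_iff' measurableSet_uIoc).2 ?_
    filter_upwards [hne] with s hs hst
    rw [Set.uIoc_of_le h0] at hst
    have h1 : (s : EReal) < switchTime p d := by
      rw [hτ, EReal.coe_lt_coe_iff]
      exact lt_of_le_of_ne hst.2 hs
    simp [rate, env, h1]
  have heq : Set.EqOn (fun _ => rate p d k τ) (rate p d k) (Set.uIcc τ t) := fun s hs => by
    rw [Set.uIcc_of_le ht] at hs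
    exact (hrate s hs.1 hs.2).symm
  have hpost : IntervalIntegrable (rate p d k) volume τ t :=
    (intervalIntegrable_const (μ := volume)).congr fun s hs => heq (Set.uIoc_subset_uIcc hs)
  rw [level, level, ← intervalIntegral.integral_add_adjacent_intervals hpre hpost,
    ← intervalIntegral.integral_congr heq, intervalIntegral.integral_const, smul_eq_mul]

/-- The pathwise convergence of the observed switching times to the first ruin time, given a grid
that becomes macroscopically regular. -/
theorem tendsto_sigma (hpos : ∀ k ℓ, 0 < d.gap k ℓ)
    (hx : ∀ k, Tendsto (epoch (d.gap k)) atTop atTop) {h : ℕ → Fin 2 → ℕ → ℝ}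
    (hmono : ∀ k, ∀ᶠ n in atTop, Monotone (grid d (h n) k))
    (hlim : ∀ k, ∀ c : ℚ, 0 < c →
      Tendsto (fun n : ℕ => grid d (h n) k ⌈(c : ℝ) * n⌉₊) atTop (𝓝 c))
    (hT : ruinTime p d < ⊤) :
    (∀ j, Tendsto (fun n => sigmaStar p d (h n) j) atTop (𝓝 (ruinTime p d))) ∧
      (rate p d (order p d 0) (ruinTime p d).toReal < 0 →
        ∀ j, Tendsto (fun n => sigmaNeg p d (h n) j) atTop (𝓝 (ruinTime p d))) := by
  have hrs := ruinTime_eq_switchTime p d hpos hx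
  obtain ⟨τ, hτ0, hτ, hzero, hne⟩ := exists_switchTime_eq p hpos hx (hrs ▸ hT)
  have hrτ : ruinTime p d = τ := hrs.trans hτ
  have hg0 : ∀ n ℓ, 0 ≤ grid d (h n) (order p d 0) ℓ := fun n ℓ => superEpoch_nonneg ℓ
  refine ⟨fun j => ?_, fun hneg j => ?_⟩
  · obtain ⟨hlow, hup⟩ := index_bracket hτ0 (hmono (order p d 0)) hg0 (hlim _)
      (Q := fun t => ruinTime p d < (t : EReal)) (fun t _ ht => by simpa [hrτ] using ht)
      one_pos (fun t ht _ => by simpa [hrτ] using ht)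
    rw [hrτ]
    exact tendsto_gridAt p d hτ0 (hmono _) (hlim _) hlow hup
  · rw [hrτ, EReal.toReal_coe] at hneg
    set k := order p d 0 with hk
    have hlevel : level p d k τ = 0 := by
      refine level_order_zero p hrτ (hzero.imp fun i hi => ?_)
      rw [level_eq_pre p d i hτ0.le hτ.ge, hi]
    obtain ⟨δ, hδ, hrate⟩ := exists_rate_eq_right p k (hx k) hτ
    -- The level is 0 at time 0, positive until τ, 0 at τ, and has constant negative slope on [τ, τ
    -- + δ).
    obtain ⟨hlow, hup⟩ := index_bracket hτ0 (hmono k) hg0 (hlim k)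
      (Q := fun t => level p d k t < 0) (fun t h0 ht => by
        rcases h0.eq_or_lt with rfl | h0
        · simp [level]
        rcases ht.eq_or_lt with rfl | ht
        · simp [hlevel]
        rw [level_eq_pre p d k h0.le (by rw [hτ]; exact EReal.coe_le_coe_iff.2 ht.le)]
        exact not_lt.2
          (preLevel_pos p k (hpos k) (hx k) (fun s h1 h2 => hne s h1 h2 k) h0 ht).le)
      hδ (fun t h1 h2 => by
        rw [level_eq_add p k (hx k) hτ0.le hτ h1.le
          fun s hs hst => hrate s hs (hst.trans_lt h2), hlevel, zero_add]
        exact mul_neg_of_pos_of_neg (sub_pos.2 h1) hneg)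
    rw [hrτ]
    exact tendsto_gridAt p d hτ0 (hmono _) (hlim _) hlow hup

end Ruin

end Path
-- Poisson gaps inside the model, and the theorem.
section Model

variable {E S : Fin 2 → Type*} [∀ k, Fintype (E k)] [∀ k, Fintype (S k)]
  [∀ k, DecidableEq (E k)] [∀ k, DecidableEq (S k)] {Ω : Type*} [MeasurableSpace Ω]
  {p : Params E S} {μ : Measure Ω} {γ : ℝ} {D : Ω → Drive E S} {H : Ω → Fin 2 → ℕ → ℝ}

theorem IsObservedModel.isPoissonGaps_gap (h : IsObservedModel p μ γ D H) (k : Fin 2) :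
    IsPoissonGaps μ p.γ₀ fun ω => (D ω).gap k where
  measurable ℓ := measurable_iff_comap_le.2 (h.measurable (.gap k ℓ))
  indep := h.indep.precomp (g := Source.gap k) fun _ _ hab => by injection hab
  law := h.gap_law k

theorem IsObservedModel.isPoissonGaps_hat (h : IsObservedModel p μ γ D H) (k : Fin 2) :
    IsPoissonGaps μ (γ - p.γ₀) fun ω => H ω k where
  measurable ℓ := measurable_iff_comap_le.2 (h.measurable (.hat k ℓ))
  indep := h.indep.precomp (g := Source.hat k) fun _ _ hab => by injection hab
  law := h.hat_law k

end Model

end RuinFluid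

theorem corollary1 {E S : Fin 2 → Type*} [∀ k, Fintype (E k)] [∀ k, Fintype (S k)]
    [∀ k, DecidableEq (E k)] [∀ k, DecidableEq (S k)]
    {Ω : Type*} [MeasurableSpace Ω] (μ : Measure Ω) [IsProbabilityMeasure μ]
    (p : RuinFluid.Params E S) (D : Ω → RuinFluid.Drive E S)
    (H : ℕ → Ω → Fin 2 → ℕ → ℝ)
    (hmodel : ∀ γ : ℕ, p.γ₀ < γ → RuinFluid.IsObservedModel p μ γ D (H γ)) :
    ∀ᵐ ω ∂μ, RuinFluid.ruinTime p (D ω) < ⊤ →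
      (∀ j : Fin 2, Tendsto (fun γ : ℕ => RuinFluid.sigmaStar p (D ω) (H γ ω) j) atTop
        (𝓝 (RuinFluid.ruinTime p (D ω)))) ∧
      (RuinFluid.rate p (D ω) (RuinFluid.order p (D ω) 0)
          (RuinFluid.ruinTime p (D ω)).toReal < 0 →
        ∀ j : Fin 2, Tendsto (fun γ : ℕ => RuinFluid.sigmaNeg p (D ω) (H γ ω) j) atTop
          (𝓝 (RuinFluid.ruinTime p (D ω)))) := by
  -- The law of `D` does not depend on γ, so one admissible value suffices to read it off.
  obtain ⟨γ₁, hγ₁⟩ := exists_nat_gt p.γ₀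
  have hlarge : ∀ᶠ γ : ℕ in atTop, p.γ₀ < γ :=
    tendsto_natCast_atTop_atTop.eventually_gt_atTop p.γ₀
  have hgap := fun k => (hmodel γ₁ hγ₁).isPoissonGaps_gap k
  have hhat := fun (γ : ℕ) (hγ : p.γ₀ < γ) k => (hmodel γ hγ).isPoissonGaps_hat k
  have hhat_pos : ∀ᵐ ω ∂μ, ∀ γ : ℕ, p.γ₀ < γ → ∀ k ℓ, 0 < H γ ω k ℓ := by
    simp only [ae_all_iff]
    intro γ hγ k
    exact ae_all_iff.1 ((hhat γ hγ k).ae_pos (sub_pos.2 hγ))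
  have hhat_top : ∀ᵐ ω ∂μ, ∀ γ : ℕ, p.γ₀ < γ → ∀ k,
      Tendsto (RuinFluid.epoch (H γ ω k)) atTop atTop := by
    simp only [ae_all_iff]
    exact fun γ hγ k => (hhat γ hγ k).ae_tendsto_epoch_atTop (sub_pos.2 hγ)
  have hhat_lim : ∀ᵐ ω ∂μ, ∀ (k : Fin 2) (c : ℚ), 0 < c → Tendsto
      (fun γ : ℕ => RuinFluid.epoch (H γ ω k) ⌈(c : ℝ) * γ⌉₊) atTop (𝓝 c) := by
    simp only [ae_all_iff]
    exact fun k c hc => RuinFluid.ae_tendsto_epoch_ceil (X := fun γ ω => H γ ω k)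
      (fun γ hγ => hhat γ hγ k) (Rat.cast_pos.2 hc)
  filter_upwards [ae_all_iff.2 fun k => (hgap k).ae_pos p.γ₀_pos,
    ae_all_iff.2 fun k => (hgap k).ae_tendsto_epoch_atTop p.γ₀_pos,
    hhat_pos, hhat_top, hhat_lim] with ω hpos hx hy0 hy hlim hT
  -- From here ω is fixed. The bounds hold only eventually because `H γ` is unconstrained for γ ≤
  -- γ₀.
  have hz0 : ∀ k, ∀ᶠ γ : ℕ in atTop, ∀ ℓ, 0 ≤ H γ ω k ℓ := fun k =>
    hlarge.mono fun γ hγ ℓ => (hy0 γ hγ k ℓ).le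
  have hz : ∀ k, ∀ᶠ γ : ℕ in atTop, Tendsto (RuinFluid.epoch (H γ ω k)) atTop atTop := fun k =>
    hlarge.mono fun γ hγ => hy γ hγ k
  refine RuinFluid.tendsto_sigma p hpos hx (fun k => ?_) (fun k c hc => ?_) hT
  · filter_upwards [hz0 k, hz k] with γ h0 h1 using RuinFluid.superEpoch_mono h0 h1
  · exact RuinFluid.tendsto_superEpoch_ceil (hx k) (hz0 k) (hz k) (hlim k) hc
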